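/- Let $d\ge 0$, let $\mu_d$ be $d$-dimensional Lebesgue measure on Euclidean space $\mathbb{R}^d$, and let $D\subset\mathbb{R}^d$ be a compact set with $D=\overline{D^\circ}$ and $\mu_d(\partial D)=0$. Let $\mathcal F=\{f_1,\dots,f_k\}$ be a finite family of injective contractions $f_i:\mathbb{R}^d\to\mathbb{R}^d$ (each $f_i$ is Lipschitz with some constant $<1$), write $\Phi(S)=\bigcup_{i=1}^k f_i(S)$ for $S\subset\mathbb{R}^d$, and let $E$ be the attractor of $\mathcal F$, i.e. the unique non-empty compact set with $E=\Phi(E)$. Assume that $\mu_d(E)=0$. Call a finite list of sets mutually disjoint in measure if the intersection of any two of them (at different positions in the list) has $\mu_d$-measure $0$. Suppose that there exists $Y\subset D$ such that 1. $\overline{Y^\circ}=Y$ and $\mu_d(\partial Y)=0$; 2. $Y, f_1(Y),\dots,f_k(Y)$ are subsets of $D$ which are mutually disjoint in measure; 3. $Y, f_1\big(D\setminus\Phi(Y)\big),\dots,f_k\big(D\setminus\Phi(Y)\big)$ are subsets of $D$ which are mutually disjoint in measure. Then $D$ admits a dissection with respect to $\mathcal F$, that is, there exists a compact set $X\subset\mathbb{R}^d$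 with $\overline{X^\circ}=X$ such that $$D = X\cup f_1(X)\cup\dots\cup f_k(X)$$ and $X, f_1(X),\dots,f_k(X)$ are mutually disjoint in measure. (It is assumed neither that $f_i(D)\subset D$ for all $i$, nor that $\mu_d(f_i(D)\cap f_j(D))=0$ for $i\ne j$.) -/

import Mathlib

open MeasureTheory

namespace Dissection

/-- `ℝ^d` with the Euclidean norm; its `volume` is the Lebesgue measure `μ_d`. -/
abbrev Space (d : ℕ) : Type := EuclideanSpace ℝ (Fin d)

/-- `S` is the closure of its interior. -/
def IsRegularClosed {d : ℕ} (S : Set (Space d)) : Prop :=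
  closure (interior S) = S

/-- A self-map of `ℝ^d` that is Lipschitz with some constant `K < 1`. -/
def IsContraction {d : ℕ} (g : Space d → Space d) : Prop :=
  ∃ K : NNReal, ContractingWith K g

/-- `Φ(S) = f_1(S) ∪ … ∪ f_k(S)`. -/
def Phi {d k : ℕ} (f : Fin k → Space d → Space d) (S : Set (Space d)) : Set (Space d) :=
  ⋃ i, f i '' S

/-- An iterated function system: a finite family of injective contractions of `ℝ^d`. -/
structure IsIFS {d k : ℕ} (f : Fin k → Space d → Space d) : Prop where
  injective : ∀ i, Function.Injective (f i)
  contraction : ∀ i, IsContraction (f i)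

/-- `E` is the attractor of the family `f`: the non-empty compact set with `E = Φ(E)`. -/
structure IsAttractor {d k : ℕ} (f : Fin k → Space d → Space d) (E : Set (Space d)) : Prop where
  nonempty : E.Nonempty
  isCompact : IsCompact E
  eq_Phi : E = Phi f E

/-- The sets `A, B_1, …, B_k` are mutually disjoint in measure: any two of them (with different
positions in the list) intersect in a Lebesgue null set. -/
def MutuallyDisjointInMeasure {d k : ℕ} (A : Set (Space d)) (B : Fin k → Set (Space d)) : Prop :=
  (∀ i, volume (A ∩ B i) = 0) ∧ ∀ i j, i ≠ j → volume (B i ∩ B j) = 0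

/-- `X` is a generator of a dissection of `D` with respect to `f`. -/
structure IsGenerator {d k : ℕ} (f : Fin k → Space d → Space d) (D X : Set (Space d)) : Prop where
  isCompact : IsCompact X
  regular : IsRegularClosed X
  cover : D = X ∪ ⋃ i, f i '' X
  disjoint : MutuallyDisjointInMeasure X (fun i => f i '' X)

/-- The family `f` admits a dissection of `D`. -/
def AdmitsDissection {d k : ℕ} (f : Fin k → Space d → Space d) (D : Set (Space d)) : Prop :=
  ∃ X : Set (Space d), IsGenerator f D X

end Dissection

/-! Up to null sets, a generator is a fixed point of the antitone map `S ↦ D \ Φ(S)`, realised on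
open sets by `openCompl`; call it `A`. With `U = interior Y`, hypothesis 2 gives `U ⊆ A U` and
hypothesis 3 gives `U ⊆ A (A U)`. Hence the iterates `u n` of `A ∘ A` at `U` increase, the sets `v n
= A (u n)` decrease, and `W = ⋃ u n` lies in `Z = ⋂ v n`. Almost everywhere `Z = D \ Φ(W)` and `W =
D \ Φ(Z)`, so `Z \ W ⊆ Φ(Z \ W)`. A bounded set with this property is null because the attractor is
(`volume_eq_zero_of_ae_subset_Phi`). So `W = Z` almost everywhere, and `X = closure W` is the
generator.

The analytic difficulty is that boundaries must stay null under `A`, although the `f i` need not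
have Lipschitz inverses. This follows from `volume_image_diff_interior_image`: the critical values
and the image of the non-differentiability set are null, and elsewhere the map is open by a
topological argument resting on the no-retraction theorem, proved by the Milnor–Rogers volume
polynomial. -/

namespace Dissection

open Set Metric Polynomial
open scoped NNReal Topology

/-! ### Interpolation, determinants and Lipschitz estimates -/

section Degree

variable {V : Type*} [NormedAddCommGroup V] [InnerProductSpace ℝ V]

/-- The value at `1` of a polynomial of bounded degree is a fixed affine combination of its values
at nodes chosen in a given interval `(0, δ)`. -/
lemma exists_nodes_eval_one (n : ℕ) {δ : ℝ} (hδ : 0 < δ) :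
    ∃ (s : Finset ℝ) (w : ℝ → ℝ), (∀ t ∈ s, 0 < t ∧ t < δ) ∧ ∑ t ∈ s, w t = 1 ∧
      ∀ p : ℝ[X], p.natDegree ≤ n → p.eval 1 = ∑ t ∈ s, w t * p.eval t := by
  classical
  obtain ⟨s, hs, hcard⟩ := (Ioo_infinite hδ).exists_subset_card_eq (n + 1)
  have hinj : InjOn (id : ℝ → ℝ) s := Function.injective_id.injOn
  refine ⟨s, fun t => (Lagrange.basis s id t).eval 1, fun t ht => hs ht, ?_, fun p hp => ?_⟩
  · have h := Lagrange.sum_basis hinj (Finset.card_pos.1 (by omega))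
    rw [← eval_finsetSum, h, eval_one]
  · have h := Lagrange.eq_interpolate (f := p) hinj (by
      rw [hcard]
      exact (degree_le_natDegree).trans_lt (by exact_mod_cast Nat.lt_succ_of_le hp))
    conv_lhs => rw [h]
    rw [Lagrange.interpolate_apply, eval_finsetSum]
    simp [mul_comm]

/-- `t ↦ det (1 + t A)` is a polynomial function of degree at most the dimension. -/
lemma exists_polynomial_det_one_add_smul [FiniteDimensional ℝ V] (A : V →L[ℝ] V) :
    ∃ p : ℝ[X], p.natDegree ≤ Module.finrank ℝ V ∧
      ∀ t : ℝ, p.eval t = (1 + t • A : V →L[ℝ] V).det := by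
  classical
  let b := Module.finBasis ℝ V
  let M := LinearMap.toMatrix b b (A : V →ₗ[ℝ] V)
  refine ⟨((X : ℝ[X]) • M.map C + (1 : Matrix _ _ ℝ).map C).det, ?_, fun t => ?_⟩
  · simpa using natDegree_det_X_add_C_le M 1
  · have h := (evalRingHom t).map_det ((X : ℝ[X]) • M.map C + (1 : Matrix _ _ ℝ).map C)
    rw [coe_evalRingHom] at h
    rw [h, ContinuousLinearMap.det, ← LinearMap.det_toMatrix b]
    congr 1
    have e : ((1 + t • A : V →L[ℝ] V) : V →ₗ[ℝ] V)
        = LinearMap.id + t • (A : V →ₗ[ℝ] V) := by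
      ext x; simp
    rw [e, LinearEquiv.map_add, LinearEquiv.map_smul, LinearMap.toMatrix_id]
    ext i j
    by_cases hij : i = j <;> simp [M, hij, add_comm, mul_comm t]

lemma norm_inv_smul_sub_inv_smul_le {ε : ℝ} (hε : 0 < ε) {z w : V} (hz : ε ≤ ‖z‖) (hw : ε ≤ ‖w‖) :
    ‖‖z‖⁻¹ • z - ‖w‖⁻¹ • w‖ ≤ 2 / ε * ‖z - w‖ := by
  have hz0 : 0 < ‖z‖ := hε.trans_le hz
  have hw0 : 0 < ‖w‖ := hε.trans_le hw
  have e : ‖z‖⁻¹ • z - ‖w‖⁻¹ • w = ‖z‖⁻¹ • (z - w) + (‖z‖⁻¹ - ‖w‖⁻¹) • w := by module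
  have h1 : ‖(‖z‖⁻¹ - ‖w‖⁻¹) • w‖ ≤ ‖z‖⁻¹ * ‖z - w‖ := by
    have : (‖z‖⁻¹ - ‖w‖⁻¹) = ‖z‖⁻¹ * (‖w‖⁻¹ * (‖w‖ - ‖z‖)) := by field_simp
    rw [this, norm_smul, norm_mul, norm_mul, norm_inv, norm_inv, norm_norm, norm_norm, mul_assoc,
      mul_right_comm, inv_mul_cancel₀ hw0.ne', one_mul, norm_sub_rev z w]
    exact mul_le_mul_of_nonneg_left (abs_norm_sub_norm_le w z) (by positivity)
  have h2 : ‖z‖⁻¹ ≤ ε⁻¹ := inv_anti₀ hε hz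
  rw [e]
  refine (norm_add_le _ _).trans ?_
  rw [norm_smul, norm_inv, norm_norm]
  calc ‖z‖⁻¹ * ‖z - w‖ + ‖(‖z‖⁻¹ - ‖w‖⁻¹) • w‖ ≤ 2 * (‖z‖⁻¹ * ‖z - w‖) := by linarith
    _ ≤ 2 * (ε⁻¹ * ‖z - w‖) := by gcongr
    _ = 2 / ε * ‖z - w‖ := by ring

/-- Cutting off a Lipschitz map outside a ball. -/
lemma lipschitz_smul_of_support {h : V → V} {φ : V → ℝ} {K L : ℝ≥0} {r : ℝ} (hr : 0 < r)
    (hh : LipschitzWith K h) (h0 : h 0 = 0) (hφ : LipschitzWith L φ) (hφ1 : ∀ y, |φ y| ≤ 1)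
    (hφ0 : ∀ y, r ≤ ‖y‖ → φ y = 0) :
    LipschitzWith (K + L * (K * r.toNNReal)) (fun y => φ y • h y) := by
  -- The product rule evaluates `h` only at `z`, so one point in the ball suffices; by symmetry it
  -- may be either one.
  have key : ∀ y z, ‖z‖ ≤ r →
      ‖φ y • h y - φ z • h z‖ ≤ (K + L * (K * r)) * ‖y - z‖ := by
    intro y z hz
    have e : φ y • h y - φ z • h z = φ y • (h y - h z) + (φ y - φ z) • h z := by module
    have hb : ‖h z‖ ≤ K * r := by
      have := hh.norm_sub_le z 0
      rw [h0, sub_zero, sub_zero] at this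
      exact this.trans (by gcongr)
    rw [e]
    refine (norm_add_le _ _).trans ?_
    rw [norm_smul, norm_smul, Real.norm_eq_abs]
    have h1 := hφ.norm_sub_le y z
    calc |φ y| * ‖h y - h z‖ + ‖φ y - φ z‖ * ‖h z‖
        ≤ 1 * (K * ‖y - z‖) + (L * ‖y - z‖) * (K * r) := by
          gcongr
          · exact hφ1 y
          · exact hh.norm_sub_le y z
      _ = _ := by ring
  refine LipschitzWith.of_dist_le_mul fun y z => ?_
  rw [dist_eq_norm, dist_eq_norm]
  push_cast
  rw [Real.coe_toNNReal _ hr.le]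
  rcases le_total ‖z‖ r with hz | hz
  · exact key y z hz
  · rcases le_total ‖y‖ r with hy | hy
    · rw [norm_sub_rev, norm_sub_rev y]
      exact key z y hy
    · rw [hφ0 y hy, hφ0 z hz]
      simp only [zero_smul, sub_zero, norm_zero]
      positivity

/-! ### No Lipschitz retraction; openness of Lipschitz maps almost everywhere -/

variable [FiniteDimensional ℝ V] [MeasurableSpace V] [BorelSpace V]

lemma volume_image_eq_zero_of_lipschitz {f : V → V} {K : ℝ≥0} (hf : LipschitzWith K f) {s : Set V}
    (hs : volume s = 0) : volume (f '' s) = 0 := by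
  have h1 : (μH[(Module.finrank ℝ V : ℝ)] : Measure V) s = 0 :=
    Measure.absolutelyContinuous_isAddHaarMeasure _ volume hs
  refine Measure.absolutelyContinuous_isAddHaarMeasure _ (μH[(Module.finrank ℝ V : ℝ)]) ?_
  refine le_antisymm ((hf.hausdorffMeasure_image_le (Nat.cast_nonneg _) s).trans ?_) zero_le
  simp [h1]

/-- There is no Lipschitz retraction of a ball onto its boundary sphere. -/
lemma not_lipschitz_retraction {r : V → V} {K : ℝ≥0} (hr : LipschitzWith K r) {R : ℝ} (hR : 0 < R)
    (hnorm : ∀ x, ‖r x‖ = R) (hout : ∀ x, R ≤ ‖x‖ → r x = (R / ‖x‖) • x) : False := by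
  have hu : LipschitzWith (K + 1) (fun x => r x - x) := hr.sub LipschitzWith.id
  have hus : ∀ x y, ‖(r x - x) - (r y - y)‖ ≤ (K + 1) * ‖x - y‖ := fun x y => by
    simpa using hu.norm_sub_le x y
  obtain ⟨δ, hδ, hdet⟩ : ∃ δ > 0, ∀ M : V →L[ℝ] V, ‖M - 1‖ < δ → 0 < M.det := by
    have hc : ContinuousAt (fun M : V →L[ℝ] V => M.det) 1 :=
      ContinuousLinearMap.continuous_det.continuousAt
    have : ∀ᶠ M : V →L[ℝ] V in 𝓝 1, 0 < M.det := by
      refine hc.eventually (lt_mem_nhds ?_)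
      simp [ContinuousLinearMap.det]
    obtain ⟨δ, hδ, h⟩ := Metric.eventually_nhds_iff.1 this
    exact ⟨δ, hδ, fun M hM => h (by rwa [dist_eq_norm])⟩
  have hK : (0 : ℝ) < K + 1 := by positivity
  -- For `t < t₀`, the `1` makes `t • (r - id)` a contraction and the `δ` makes `det (1 + t • A x)`
  -- positive.
  set t₀ : ℝ := min 1 δ / (K + 1) with ht₀
  have ht₀pos : 0 < t₀ := by positivity
  set S : Set V := closedBall 0 R ∩ {x | DifferentiableAt ℝ r x} with hS
  have hSm : MeasurableSet S :=
    measurableSet_closedBall.inter (measurableSet_of_differentiableAt ℝ r)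
  have hdiff : volume (closedBall 0 R \ S) = 0 := by
    refine measure_mono_null ?_ (hr.ae_differentiableAt (μ := (volume : Measure V)))
    rintro x ⟨hx, hx'⟩ hd
    exact hx' ⟨hx, hd⟩
  set A : V → V →L[ℝ] V := fun x => fderiv ℝ r x - 1 with hA
  have hAn : ∀ x, ‖A x‖ ≤ K + 1 := fun x =>
    (norm_sub_le _ _).trans (add_le_add (norm_fderiv_le_of_lipschitz ℝ hr)
      ContinuousLinearMap.norm_id_le)
  -- For small `t`, `x ↦ x + t • (r x - x)` permutes the ball, so by change of variables its
  -- Jacobian integrates to the volume of the ball, independently of `t`.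
  have key : ∀ t : ℝ, 0 < t → t < t₀ →
      IntegrableOn (fun x => (1 + t • A x : V →L[ℝ] V).det) S ∧
        ∫ x in S, (1 + t • A x : V →L[ℝ] V).det = volume.real (closedBall (0 : V) R) := by
    intro t ht htt
    have htK : t * (K + 1) < min 1 δ := by rwa [ht₀, lt_div_iff₀ hK] at htt
    have htK1 : t * (K + 1) < 1 := htK.trans_le (min_le_left _ _)
    have ht1 : t < 1 := by nlinarith [K.coe_nonneg]
    set g : V → V := fun x => x + t • (r x - x) with hg
    have hglip : ∃ L, LipschitzWith L g :=
      ⟨_, LipschitzWith.id.add ((lipschitzWith_smul t).comp hu)⟩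
    have hinj : Function.Injective g := by
      intro x y hxy
      have e : x - y = -(t • ((r x - x) - (r y - y))) := by
        have : x + t • (r x - x) = y + t • (r y - y) := hxy
        rw [smul_sub t (r x - x), neg_sub, sub_eq_sub_iff_add_eq_add, this, add_comm]
      have : ‖x - y‖ ≤ t * (K + 1) * ‖x - y‖ := by
        conv_lhs => rw [e, norm_neg, norm_smul, Real.norm_of_nonneg ht.le]
        rw [mul_assoc]
        exact mul_le_mul_of_nonneg_left (hus x y) ht.le
      have h0 : ‖x - y‖ = 0 := by nlinarith [norm_nonneg (x - y)]
      exact sub_eq_zero.1 (norm_eq_zero.1 h0)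
    have himage : g '' closedBall 0 R = closedBall 0 R := by
      apply Subset.antisymm
      · rintro _ ⟨x, hx, rfl⟩
        rw [mem_closedBall_zero_iff] at hx ⊢
        have : g x = (1 - t) • x + t • r x := by simp only [hg]; module
        rw [this]
        refine (norm_add_le _ _).trans ?_
        rw [norm_smul, norm_smul, hnorm, Real.norm_of_nonneg ht.le,
          Real.norm_of_nonneg (by linarith)]
        nlinarith
      · intro w hw
        rw [mem_closedBall_zero_iff] at hw
        have hc : ContractingWith (Real.toNNReal (t * (K + 1))) (fun x => w - t • (r x - x)) := by
          refine ⟨by rw [Real.toNNReal_lt_one]; exact htK1, LipschitzWith.of_dist_le_mul ?_⟩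
          intro x y
          rw [dist_eq_norm, dist_eq_norm, Real.coe_toNNReal _ (by positivity),
            sub_sub_sub_cancel_left, ← smul_sub, norm_smul, Real.norm_of_nonneg ht.le, mul_assoc,
            norm_sub_rev x y]
          exact mul_le_mul_of_nonneg_left (hus y x) ht.le
        have hfix := hc.fixedPoint_isFixedPt
        set x := ContractingWith.fixedPoint _ hc
        have hgx : g x = w := by
          have h : w - t • (r x - x) = x := hfix
          simp only [hg]
          nth_rw 1 [← h]
          abel
        refine ⟨x, ?_, hgx⟩
        rw [mem_closedBall_zero_iff]
        -- A point outside the ball moves radially to norm `(1 - t) * ‖x‖ + t * R > R`, so it cannot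
        -- map to `w`.
        by_contra! hx
        have hx0 : 0 < ‖x‖ := hR.trans hx
        have e : g x = ((1 - t) + t * (R / ‖x‖)) • x := by
          simp only [hg, hout x hx.le]; module
        have hn : ‖g x‖ = (1 - t) * ‖x‖ + t * R := by
          have : 0 ≤ t * (R / ‖x‖) := by positivity
          rw [e, norm_smul, Real.norm_of_nonneg (by linarith)]
          field_simp
        rw [hgx] at hn
        nlinarith
    have himS : volume.real (g '' S) = volume.real (closedBall (0 : V) R) := by
      obtain ⟨L, hL⟩ := hglip
      have h1 : volume (g '' (closedBall 0 R \ S)) = 0 :=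
        volume_image_eq_zero_of_lipschitz hL hdiff
      have h2 : closedBall 0 R = g '' S ∪ g '' (closedBall 0 R \ S) := by
        rw [← image_union, union_sdiff_cancel inter_subset_left, himage]
      rw [measureReal_def, measureReal_def, h2]
      congr 1
      refine le_antisymm (measure_mono subset_union_left) ((measure_union_le _ _).trans ?_)
      rw [h1, add_zero]
    have hderiv : ∀ x ∈ S, HasFDerivWithinAt g (1 + t • A x) S x := by
      intro x hx
      have hd : HasFDerivAt r (fderiv ℝ r x) x := hx.2.hasFDerivAt
      exact ((hasFDerivAt_id x).add ((hd.sub (hasFDerivAt_id x)).const_smul t)).hasFDerivWithinAt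
    have hpos : ∀ x, |(1 + t • A x : V →L[ℝ] V).det| • (1 : ℝ) = (1 + t • A x : V →L[ℝ] V).det := by
      intro x
      rw [smul_eq_mul, mul_one, abs_of_pos]
      apply hdet
      rw [add_sub_cancel_left, norm_smul, Real.norm_of_nonneg ht.le]
      exact (mul_le_mul_of_nonneg_left (hAn x) ht.le).trans_lt (htK.trans_le (min_le_right _ _))
    have hint := integrableOn_image_iff_integrableOn_abs_det_fderiv_smul volume hSm hderiv
      hinj.injOn (fun _ => (1 : ℝ))
    have heq := integral_image_eq_integral_abs_det_fderiv_smul volume hSm hderiv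
      hinj.injOn (fun _ => (1 : ℝ))
    simp only [hpos] at hint heq
    refine ⟨hint.1 ?_, ?_⟩
    · refine integrableOn_const (ne_of_lt (lt_of_le_of_lt (measure_mono (t := closedBall 0 R) ?_)
        measure_closedBall_lt_top))
      rw [← himage]
      exact image_mono inter_subset_left
    · rw [← heq]
      simp [himS]
  -- Interpolating pointwise carries the constant integral from small `t` to `t = 1`, where the
  -- Jacobian vanishes; the ball would then have volume `0`.
  obtain ⟨s, w, hs, hw, hp⟩ := exists_nodes_eval_one (Module.finrank ℝ V) ht₀pos
  have hdet1 : ∀ x ∈ S, (1 + (1 : ℝ) • A x : V →L[ℝ] V).det = 0 := by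
    intro x hx
    have e : (1 + (1 : ℝ) • A x : V →L[ℝ] V) = fderiv ℝ r x := by simp [hA]
    rw [e]
    -- Differentiating `‖r‖² = R²` shows that the range of the derivative is orthogonal to `r x ≠
    -- 0`.
    by_contra hne
    have hd : HasFDerivAt r (fderiv ℝ r x) x := hx.2.hasFDerivAt
    obtain ⟨v, hv⟩ := ((fderiv ℝ r x).toContinuousLinearEquivOfDetNeZero hne).surjective (r x)
    rw [ContinuousLinearMap.toContinuousLinearEquivOfDetNeZero_apply] at hv
    have h1 := hd.inner ℝ hd
    have h2 : HasFDerivAt (fun y => inner ℝ (r y) (r y)) (0 : V →L[ℝ] ℝ) x := by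
      have : (fun y => inner ℝ (r y) (r y)) = fun _ : V => R ^ 2 := by
        ext y; rw [real_inner_self_eq_norm_sq, hnorm]
      rw [this]; exact hasFDerivAt_const _ _
    have h3 := congrArg (fun L : V →L[ℝ] ℝ => L v) (h1.unique h2)
    simp [hv, hnorm] at h3
    exact hR.ne' h3
  have hsum : ∀ x ∈ S, ∑ t ∈ s, w t * (1 + t • A x : V →L[ℝ] V).det = 0 := by
    intro x hx
    obtain ⟨p, hpd, hpe⟩ := exists_polynomial_det_one_add_smul (A x)
    have := hp p hpd
    rw [hpe 1, hdet1 x hx] at this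
    simpa [hpe] using this.symm
  have hzero : ∫ x in S, ∑ t ∈ s, w t * (1 + t • A x : V →L[ℝ] V).det = 0 := by
    rw [setIntegral_congr_fun hSm hsum]; simp
  rw [integral_finsetSum _ fun t ht => ((key t (hs t ht).1 (hs t ht).2).1.const_mul _)] at hzero
  rw [Finset.sum_congr rfl (g := fun t => w t * volume.real (closedBall (0 : V) R)) fun t ht => by
    rw [integral_const_mul, (key t (hs t ht).1 (hs t ht).2).2]] at hzero
  rw [← Finset.sum_mul, hw, one_mul, measureReal_def, ENNReal.toReal_eq_zero_iff] at hzero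
  rcases hzero with h | h
  · exact (measure_closedBall_pos volume (0 : V) hR).ne' h
  · exact measure_closedBall_lt_top.ne h

/-- A Lipschitz self-map that is the identity outside a ball is surjective. -/
lemma surjective_of_lipschitz_of_eq_self {G : V → V} {K : ℝ≥0} (hG : LipschitzWith K G) {R : ℝ}
    (hR : 0 < R) (hid : ∀ x, R ≤ ‖x‖ → G x = x) : Function.Surjective G := by
  suffices H : ∀ {G : V → V} {R : ℝ}, LipschitzWith K G → 0 < R → (∀ x, R ≤ ‖x‖ → G x = x) →
      ∃ x, G x = 0 by
    intro p
    have hlip : LipschitzWith K (fun x => G (x + p) - p) :=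
      LipschitzWith.of_dist_le_mul fun x y => by
        simpa [dist_eq_norm] using hG.dist_le_mul (x + p) (y + p)
    obtain ⟨x, hx⟩ := H (R := R + ‖p‖) hlip (by positivity) fun x hx => by
      have h := norm_sub_le (x + p) p
      rw [add_sub_cancel_right] at h
      rw [hid (x + p) (by linarith), add_sub_cancel_right]
    exact ⟨x + p, sub_eq_zero.1 hx⟩
  intro G R hG hR hid
  -- If `G` omits `0`, compactness bounds `‖G‖` below, and `R • G / ‖G‖` is a forbidden retraction.
  by_contra! hne
  obtain ⟨x₀, -, hx₀⟩ := (isCompact_closedBall (0 : V) R).exists_isMinOn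
    ⟨0, by simp [hR.le]⟩ (hG.continuous.norm.continuousOn)
  set ε := min ‖G x₀‖ R
  have hε : 0 < ε := lt_min (norm_pos_iff.2 (hne x₀)) hR
  have hlow : ∀ x, ε ≤ ‖G x‖ := by
    intro x
    rcases le_total ‖x‖ R with h | h
    · exact (min_le_left _ _).trans (hx₀ (mem_closedBall_zero_iff.2 h))
    · rw [hid x h]; exact (min_le_right _ _).trans h
  have hr : LipschitzWith (Real.toNNReal (R * (2 / ε * K))) (fun x => R • (‖G x‖⁻¹ • G x)) := by
    refine LipschitzWith.of_dist_le_mul fun x y => ?_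
    rw [Real.coe_toNNReal _ (by positivity), dist_eq_norm, ← smul_sub, norm_smul,
      Real.norm_of_nonneg hR.le, mul_assoc, mul_assoc]
    gcongr
    refine (norm_inv_smul_sub_inv_smul_le hε (hlow x) (hlow y)).trans ?_
    gcongr
    exact hG.norm_sub_le x y |>.trans_eq (by rw [dist_eq_norm])
  refine not_lipschitz_retraction hr hR (fun x => ?_) (fun x hx => ?_)
  · have := (hε.trans_le (hlow x)).ne'
    rw [norm_smul, norm_smul, norm_inv, norm_norm, inv_mul_cancel₀ this, mul_one,
      Real.norm_of_nonneg hR.le]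
  · simp only [hid x hx, smul_smul, div_eq_mul_inv]

/-- A Lipschitz map is open at every point where it is differentiable with invertible derivative. -/
lemma image_mem_nhds_of_hasFDerivAt_of_det_ne_zero {f : V → V} {K : ℝ≥0} (hf : LipschitzWith K f)
    {f' : V →L[ℝ] V} {x : V} (hfx : HasFDerivAt f f' x) (hdet : f'.det ≠ 0) {S : Set V}
    (hS : S ∈ 𝓝 x) : f '' S ∈ 𝓝 (f x) := by
  set e := f'.toContinuousLinearEquivOfDetNeZero hdet with he
  have hee : ∀ v, e v = f' v := fun v => rfl
  set g : V → V := fun y => e.symm (f (x + y) - f x) with hg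
  have hh : LipschitzWith (‖(e.symm : V →L[ℝ] V)‖₊ * K + 1) (fun y => g y - y) := by
    refine LipschitzWith.sub ?_ LipschitzWith.id
    refine (e.symm : V →L[ℝ] V).lipschitz.comp (LipschitzWith.of_dist_le_mul fun y z => ?_)
    simpa [dist_eq_norm] using hf.dist_le_mul (x + y) (x + z)
  have hgd : HasFDerivAt g (ContinuousLinearMap.id ℝ V) 0 := by
    have h1 : HasFDerivAt (fun y => f (x + y) - f x) f' 0 := by
      have h3 : HasFDerivAt (fun y : V => x + y) (ContinuousLinearMap.id ℝ V) 0 :=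
        (hasFDerivAt_id (0 : V)).const_add x
      have h2 : HasFDerivAt f f' (x + 0) := by rwa [add_zero]
      exact (HasFDerivAt.comp (0 : V) h2 h3).sub_const (f x)
    have h2 := (e.symm : V →L[ℝ] V).hasFDerivAt.comp (0 : V) h1
    have h3 : (e.symm : V →L[ℝ] V).comp f' = ContinuousLinearMap.id ℝ V := by
      ext v; simp [← hee]
    rw [h3] at h2
    exact h2
  have hg0 : g 0 = 0 := by simp [hg]
  obtain ⟨r, hr, hball⟩ : ∃ r > 0, ∀ y, ‖y‖ ≤ r → ‖g y - y‖ ≤ 1 / 2 * ‖y‖ ∧ x + y ∈ S := by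
    have h1 := hgd.isLittleO.def (c := 1 / 2) (by norm_num)
    have h2 : ∀ᶠ y in 𝓝 (0 : V), x + y ∈ S := by
      have : Filter.Tendsto (fun y => x + y) (𝓝 (0 : V)) (𝓝 x) := by
        have : Continuous fun y : V => x + y := by fun_prop
        simpa using this.tendsto 0
      exact this hS
    obtain ⟨r, hr, h⟩ := Metric.eventually_nhds_iff.1 (h1.and h2)
    refine ⟨r / 2, by positivity, fun y hy => ?_⟩
    have := h (y := y) (by rw [dist_zero_right]; linarith)
    simpa [hg0] using this
  -- The cutoff is `1` up to radius `r / 2` and `0` beyond `r`, so `y + φ y • (g y - y)`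
  -- interpolates between `g` and the identity and is surjective.
  set φ : V → ℝ := fun y => max 0 (min 1 (2 - 2 / r * ‖y‖)) with hφ
  obtain ⟨L, hφL⟩ : ∃ L, LipschitzWith L φ := by
    have : LipschitzWith (Real.toNNReal (2 / r)) fun y : V => 2 - 2 / r * ‖y‖ := by
      refine LipschitzWith.of_dist_le_mul fun y z => ?_
      rw [Real.coe_toNNReal _ (by positivity), Real.dist_eq, sub_sub_sub_cancel_left, ← mul_sub,
        abs_mul, abs_of_pos (by positivity), dist_comm, dist_eq_norm]
      exact mul_le_mul_of_nonneg_left (abs_norm_sub_norm_le z y) (by positivity)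
    exact ⟨_, (this.const_min 1).const_max 0⟩
  have hφ1 : ∀ y, 0 ≤ φ y ∧ φ y ≤ 1 := fun y =>
    ⟨le_max_left _ _, max_le zero_le_one (min_le_left _ _)⟩
  have hφ0 : ∀ y, r ≤ ‖y‖ → φ y = 0 := by
    intro y hy
    have : 2 ≤ 2 / r * ‖y‖ := by
      rw [div_mul_eq_mul_div, le_div_iff₀ hr]; linarith
    exact max_eq_left ((min_le_right _ _).trans (by linarith))
  have hφh : ∀ y, ‖y‖ ≤ r / 2 → φ y = 1 := by
    intro y hy
    have : 2 / r * ‖y‖ ≤ 1 := by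
      rw [div_mul_eq_mul_div, div_le_iff₀ hr]; linarith
    simp only [hφ]
    rw [min_eq_left (by linarith), max_eq_right zero_le_one]
  have hG := LipschitzWith.id.add (lipschitz_smul_of_support hr hh (by simp [hg0]) hφL
    (fun y => by rw [abs_of_nonneg (hφ1 y).1]; exact (hφ1 y).2) hφ0)
  have hsurj := surjective_of_lipschitz_of_eq_self hG hr (fun y hy => by simp [hφ0 y hy])
  -- A preimage `y` of `p` has `‖y‖ ≤ ‖p‖ + ‖y‖ / 2`, so `‖p‖ < r / 4` puts `y` where `φ = 1`.
  have hcover : ball (0 : V) (r / 4) ⊆ g '' closedBall 0 r := by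
    intro p hp
    rw [mem_ball_zero_iff] at hp
    obtain ⟨y, hy⟩ := hsurj p
    replace hy : y + φ y • (g y - y) = p := hy
    have hyr : ‖y‖ ≤ r := by
      by_contra! h
      rw [hφ0 y h.le, zero_smul, add_zero] at hy
      rw [← hy] at hp
      linarith
    have hy2 : ‖y‖ ≤ r / 2 := by
      have h1 : ‖φ y • (g y - y)‖ ≤ 1 / 2 * ‖y‖ := by
        rw [norm_smul, Real.norm_of_nonneg (hφ1 y).1]
        exact (mul_le_of_le_one_left (norm_nonneg _) (hφ1 y).2).trans (hball y hyr).1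
      have h2 : ‖y‖ ≤ ‖p‖ + ‖φ y • (g y - y)‖ := by
        have : y = p - φ y • (g y - y) := by rw [← hy]; abel
        calc ‖y‖ = ‖p - φ y • (g y - y)‖ := by rw [← this]
          _ ≤ _ := norm_sub_le _ _
      linarith
    refine ⟨y, mem_closedBall_zero_iff.2 hyr, ?_⟩
    rw [hφh y hy2] at hy
    rw [← hy]; module
  have hmem : (fun z => e.symm (z - f x)) ⁻¹' ball (0 : V) (r / 4) ∈ 𝓝 (f x) := by
    have hc : Continuous fun z => e.symm (z - f x) := by fun_prop
    refine hc.continuousAt.preimage_mem_nhds (isOpen_ball.mem_nhds ?_)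
    simp [hr]
  refine Filter.mem_of_superset hmem fun z hz => ?_
  obtain ⟨y, hy, hyz⟩ := hcover hz
  refine ⟨x + y, (hball y (mem_closedBall_zero_iff.1 hy)).2, ?_⟩
  exact sub_left_injective (e.symm.injective hyz)

/-- Up to a null set, a Lipschitz self-map of a finite-dimensional space maps open sets to
open sets. -/
lemma volume_image_diff_interior_image {f : V → V} {K : ℝ≥0} (hf : LipschitzWith K f) {U : Set V}
    (hU : IsOpen U) : volume (f '' U \ interior (f '' U)) = 0 := by
  have h1 : volume (f '' {x | ¬ DifferentiableAt ℝ f x}) = 0 :=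
    volume_image_eq_zero_of_lipschitz hf (hf.ae_differentiableAt (μ := (volume : Measure V)))
  have h2 : volume (f '' {x | DifferentiableAt ℝ f x ∧ (fderiv ℝ f x).det = 0}) = 0 :=
    addHaar_image_eq_zero_of_det_fderivWithin_eq_zero volume
      (fun x hx => hx.1.hasFDerivAt.hasFDerivWithinAt) (fun x hx => hx.2)
  refine measure_mono_null ?_ (measure_union_null h1 h2)
  rintro _ ⟨⟨x, hx, rfl⟩, hint⟩
  by_cases hd : DifferentiableAt ℝ f x
  · refine Or.inr ⟨x, ⟨hd, ?_⟩, rfl⟩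
    by_contra hne
    exact hint (mem_interior_iff_mem_nhds.2
      (image_mem_nhds_of_hasFDerivAt_of_det_ne_zero hf hd.hasFDerivAt hne (hU.mem_nhds hx)))
  · exact Or.inl ⟨x, hd, rfl⟩

end Degree

/-! ### Null sets, the attractor and the fixed point -/

section Iteration

variable {d k : ℕ} {f : Fin k → Space d → Space d}

lemma IsIFS.exists_lipschitzWith (hf : IsIFS f) (i : Fin k) : ∃ K, LipschitzWith K (f i) :=
  let ⟨K, hK⟩ := hf.contraction i
  ⟨K, hK.toLipschitzWith⟩

lemma IsIFS.continuous (hf : IsIFS f) (i : Fin k) : Continuous (f i) :=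
  let ⟨_, hK⟩ := hf.exists_lipschitzWith i
  hK.continuous

lemma Phi_mono {S T : Set (Space d)} (h : S ⊆ T) : Phi f S ⊆ Phi f T :=
  iUnion_mono fun _ => image_mono h

lemma mem_Phi {S : Set (Space d)} {x : Space d} : x ∈ Phi f S ↔ ∃ i, ∃ y ∈ S, f i y = x := by
  simp [Phi]

lemma isCompact_Phi (hf : IsIFS f) {S : Set (Space d)} (hS : IsCompact S) :
    IsCompact (Phi f S) :=
  isCompact_iUnion fun i => hS.image (hf.continuous i)

lemma ae_mem_image (hf : IsIFS f) {S T : Set (Space d)} (h : ∀ᵐ x, x ∈ S → x ∈ T) (i : Fin k) :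
    ∀ᵐ x, x ∈ f i '' S → x ∈ f i '' T := by
  obtain ⟨K, hK⟩ := hf.exists_lipschitzWith i
  refine measure_mono_null ?_ (volume_image_eq_zero_of_lipschitz hK h)
  intro x hx
  simp only [mem_compl_iff, mem_ofPred_eq, Classical.not_imp] at hx
  obtain ⟨⟨y, hy, rfl⟩, hxT⟩ := hx
  refine ⟨y, ?_, rfl⟩
  simp only [mem_compl_iff, mem_ofPred_eq, Classical.not_imp]
  exact ⟨hy, fun hyT => hxT ⟨y, hyT, rfl⟩⟩

lemma ae_mem_Phi (hf : IsIFS f) {S T : Set (Space d)} (h : ∀ᵐ x, x ∈ S → x ∈ T) :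
    ∀ᵐ x, x ∈ Phi f S → x ∈ Phi f T := by
  filter_upwards [ae_all_iff.2 (ae_mem_image hf h)] with x hx hxS
  obtain ⟨i, hi⟩ := mem_iUnion.1 hxS
  exact mem_iUnion.2 ⟨i, hx i hi⟩

lemma volume_Phi_eq_zero (hf : IsIFS f) {S : Set (Space d)} (h : volume S = 0) :
    volume (Phi f S) = 0 :=
  measure_iUnion_null fun i =>
    let ⟨_, hK⟩ := hf.exists_lipschitzWith i
    volume_image_eq_zero_of_lipschitz hK h

lemma ae_mem_interior_Phi (hf : IsIFS f) {U : Set (Space d)} (hU : IsOpen U) :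
    ∀ᵐ x, x ∈ Phi f U → x ∈ interior (Phi f U) := by
  have h : ∀ i, ∀ᵐ x, x ∉ f i '' U \ interior (f i '' U) := fun i =>
    let ⟨_, hK⟩ := hf.exists_lipschitzWith i
    measure_eq_zero_iff_ae_notMem.1 (volume_image_diff_interior_image hK hU)
  filter_upwards [ae_all_iff.2 h] with x hx hxU
  obtain ⟨i, hi⟩ := mem_iUnion.1 hxU
  have : x ∈ interior (f i '' U) := by
    by_contra hc
    exact hx i ⟨hi, hc⟩
  exact interior_mono (subset_iUnion (fun i => f i '' U) i) this

/-- Injectivity makes the preimage under each `f i` independent of `n`; finiteness of the family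
gives one `n` that excludes every `i`. -/
lemma Phi_iInter_of_antitone (hf : IsIFS f) {V : ℕ → Set (Space d)} (hV : Antitone V) :
    Phi f (⋂ n, V n) = ⋂ n, Phi f (V n) := by
  apply Subset.antisymm
  · exact subset_iInter fun n => Phi_mono (iInter_subset _ n)
  · intro z hz
    by_contra hc
    have : ∀ i, ∃ n, z ∉ f i '' V n := by
      intro i
      by_contra! h
      refine hc (mem_Phi.2 ⟨i, ?_⟩)
      obtain ⟨y, -, hy⟩ := h 0
      refine ⟨y, mem_iInter.2 fun n => ?_, hy⟩
      obtain ⟨y', hy', e⟩ := h n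
      rwa [← hf.injective i (e.trans hy.symm)]
    choose n hn using this
    obtain ⟨i, hi⟩ := mem_iUnion.1 (mem_iInter.1 hz (Finset.univ.sup n))
    exact hn i (image_mono (hV (Finset.le_sup (Finset.mem_univ i))) hi)

/-- A bounded set contained in its image under `Phi` is contained in the attractor. -/
lemma subset_attractor (hf : IsIFS f) {E : Set (Space d)} (hE : IsAttractor f E)
    {S : Set (Space d)} (hS : Bornology.IsBounded S) (h : S ⊆ Phi f S) : S ⊆ E := by
  choose K hK using hf.contraction
  set κ : ℝ≥0 := Finset.univ.sup K
  have hκ : κ < 1 := (Finset.sup_lt_iff (by simp)).2 fun i _ => (hK i).1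
  obtain ⟨M, hM⟩ : ∃ M, ∀ x ∈ S, infDist x E ≤ M := by
    obtain ⟨e, he⟩ := hE.nonempty
    obtain ⟨r, hr⟩ := hS.subset_closedBall e
    exact ⟨r, fun x hx => (infDist_le_dist_of_mem he).trans (hr hx)⟩
  have step : ∀ n : ℕ, ∀ x ∈ S, infDist x E ≤ κ ^ n * M := by
    intro n
    induction n with
    | zero => simpa using hM
    | succ n ih =>
      intro x hx
      obtain ⟨i, y, hy, rfl⟩ := mem_Phi.1 (h hx)
      obtain ⟨e, he, hye⟩ := hE.isCompact.exists_infDist_eq_dist hE.nonempty y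
      have hfe : f i e ∈ E := by
        rw [hE.eq_Phi]
        exact mem_Phi.2 ⟨i, e, he, rfl⟩
      calc infDist (f i y) E ≤ dist (f i y) (f i e) := infDist_le_dist_of_mem hfe
        _ ≤ K i * dist y e := (hK i).2.dist_le_mul y e
        _ ≤ κ * (κ ^ n * M) := by
          gcongr
          · exact Finset.le_sup (Finset.mem_univ i)
          · rw [← hye]; exact ih y hy
        _ = κ ^ (n + 1) * M := by ring
  intro x hx
  have hlim : Filter.Tendsto (fun n : ℕ => (κ : ℝ) ^ n * M) Filter.atTop (𝓝 (0 * M)) :=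
    (tendsto_pow_atTop_nhds_zero_of_lt_one κ.coe_nonneg (by exact_mod_cast hκ)).mul_const M
  have h0 : infDist x E ≤ 0 := by
    simpa using ge_of_tendsto' hlim fun n => step n x hx
  exact (hE.isCompact.isClosed.mem_iff_infDist_zero hE.nonempty).2
    (le_antisymm h0 infDist_nonneg)

/-- Deleting the forward orbit of the null set `S \ Phi f S` leaves a set genuinely contained in its
image, hence in `E`; the orbit is null because the maps are Lipschitz. -/
lemma volume_eq_zero_of_ae_subset_Phi (hf : IsIFS f) {E : Set (Space d)} (hE : IsAttractor f E)
    (hE0 : volume E = 0) {S : Set (Space d)} (hS : Bornology.IsBounded S)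
    (h : ∀ᵐ x, x ∈ S → x ∈ Phi f S) : volume S = 0 := by
  set N : ℕ → Set (Space d) := fun n => (Phi f)^[n] (S \ Phi f S) with hN
  have hN0 : ∀ n, volume (N n) = 0 := by
    intro n
    induction n with
    | zero =>
      refine measure_mono_null ?_ h
      rintro x ⟨hx, hx'⟩ hc
      exact hx' (hc hx)
    | succ n ih =>
      simp only [hN, Function.iterate_succ_apply']
      exact volume_Phi_eq_zero hf ih
  have hsub : S \ ⋃ n, N n ⊆ Phi f (S \ ⋃ n, N n) := by
    rintro x ⟨hx, hxN⟩
    simp only [mem_iUnion, not_exists] at hxN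
    have hxP : x ∈ Phi f S := by
      by_contra hc
      exact hxN 0 ⟨hx, hc⟩
    obtain ⟨i, y, hy, rfl⟩ := mem_Phi.1 hxP
    refine mem_Phi.2 ⟨i, y, ⟨hy, fun hyN => ?_⟩, rfl⟩
    obtain ⟨n, hn⟩ := mem_iUnion.1 hyN
    refine hxN (n + 1) ?_
    simp only [hN, Function.iterate_succ_apply']
    exact mem_Phi.2 ⟨i, y, hn, rfl⟩
  have hSE := subset_attractor hf hE (hS.subset sdiff_subset) hsub
  refine measure_mono_null (fun x hx => ?_) (measure_union_null hE0 (measure_iUnion_null hN0))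
  by_cases hxN : x ∈ ⋃ n, N n
  · exact Or.inr hxN
  · exact Or.inl (hSE ⟨hx, hxN⟩)

lemma isOpen_subset_of_ae_mem {O F : Set (Space d)} (hO : IsOpen O) (hF : IsClosed F)
    (h : ∀ᵐ x, x ∈ O → x ∈ F) : O ⊆ F := by
  have h0 : volume (O \ F) = 0 := by
    refine measure_mono_null ?_ h
    rintro x ⟨hx, hx'⟩ hc
    exact hx' (hc hx)
  exact sdiff_eq_empty.1 ((hO.sdiff hF).measure_eq_zero_iff volume |>.1 h0)

/-- The largest open subset of `D` that is disjoint in measure from `Phi f U`. -/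
def openCompl (f : Fin k → Space d → Space d) (D U : Set (Space d)) : Set (Space d) :=
  ⋃₀ {O | IsOpen O ∧ O ⊆ D ∧ volume (O ∩ Phi f U) = 0}

lemma isOpen_openCompl (D U : Set (Space d)) : IsOpen (openCompl f D U) :=
  isOpen_sUnion fun _ hO => hO.1

lemma openCompl_subset (D U : Set (Space d)) : openCompl f D U ⊆ D :=
  sUnion_subset fun _ hO => hO.2.1

lemma subset_openCompl {D U O : Set (Space d)} (hO : IsOpen O) (hOD : O ⊆ D)
    (h : volume (O ∩ Phi f U) = 0) : O ⊆ openCompl f D U :=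
  subset_sUnion_of_mem ⟨hO, hOD, h⟩

lemma volume_openCompl_inter_Phi (D U : Set (Space d)) :
    volume (openCompl f D U ∩ Phi f U) = 0 := by
  obtain ⟨T, hTc, hTS, hT⟩ := TopologicalSpace.isOpen_sUnion_countable
    {O | IsOpen O ∧ O ⊆ D ∧ volume (O ∩ Phi f U) = 0} fun _ hO => hO.1
  rw [openCompl, ← hT, sUnion_eq_biUnion, iUnion₂_inter]
  exact (measure_biUnion_null_iff hTc).2 fun O hO => (hTS hO).2.2

lemma openCompl_anti {D U U' : Set (Space d)} (h : U ⊆ U') :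
    openCompl f D U' ⊆ openCompl f D U :=
  sUnion_subset_sUnion fun _ hO =>
    ⟨hO.1, hO.2.1, measure_mono_null (inter_subset_inter_right _ (Phi_mono h)) hO.2.2⟩

lemma ae_notMem_frontier {S : Set (Space d)} (h : volume (frontier S) = 0) :
    ∀ᵐ x, x ∉ frontier S :=
  measure_eq_zero_iff_ae_notMem.1 h

lemma ae_mem_of_mem_closure {U : Set (Space d)} (hU : IsOpen U) (hU0 : volume (frontier U) = 0) :
    ∀ᵐ x, x ∈ closure U → x ∈ U := by
  filter_upwards [ae_notMem_frontier hU0] with x hx hxc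
  by_contra hxU
  exact hx ⟨hxc, by rwa [hU.interior_eq]⟩

/-- The open set `interior D \ Phi f (closure U)` competes in the union, and null frontiers make it
almost all of `D \ Phi f U`. -/
lemma ae_mem_openCompl_iff (hf : IsIFS f) {D U : Set (Space d)} (hD : IsCompact D)
    (hD0 : volume (frontier D) = 0) (hU : IsOpen U) (hUD : U ⊆ D) (hU0 : volume (frontier U) = 0) :
    ∀ᵐ x, x ∈ openCompl f D U ↔ x ∈ D ∧ x ∉ Phi f U := by
  have hcl : IsCompact (closure U) := hD.closure_of_subset hUD
  have hsub : interior D \ Phi f (closure U) ⊆ openCompl f D U := by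
    refine subset_openCompl (isOpen_interior.sdiff (isCompact_Phi hf hcl).isClosed)
      (sdiff_subset.trans interior_subset) ?_
    rw [(disjoint_sdiff_left.mono_right (Phi_mono subset_closure)).inter_eq, measure_empty]
  filter_upwards [ae_mem_Phi hf (ae_mem_of_mem_closure hU hU0), ae_notMem_frontier hD0,
    measure_eq_zero_iff_ae_notMem.1 (volume_openCompl_inter_Phi (f := f) D U)] with x h1 h2 h3
  refine ⟨fun h => ⟨openCompl_subset _ _ h, fun hP => h3 ⟨h, hP⟩⟩, fun ⟨hxD, hxP⟩ => ?_⟩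
  refine hsub ⟨?_, fun h => hxP (h1 h)⟩
  by_contra hc
  exact h2 ⟨subset_closure hxD, hc⟩

/-- Almost every frontier point would lie in `Phi f U`, hence in its interior, an open set disjoint
from `openCompl f D U` and so from its closure. -/
lemma volume_frontier_openCompl (hf : IsIFS f) {D U : Set (Space d)} (hD : IsCompact D)
    (hD0 : volume (frontier D) = 0) (hU : IsOpen U) (hUD : U ⊆ D) (hU0 : volume (frontier U) = 0) :
    volume (frontier (openCompl f D U)) = 0 := by
  have hdisj : Disjoint (openCompl f D U) (interior (Phi f U)) := by
    rw [disjoint_iff_inter_eq_empty]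
    refine ((isOpen_openCompl D U).inter isOpen_interior).measure_eq_zero_iff volume |>.1 ?_
    exact measure_mono_null (inter_subset_inter_right _ interior_subset)
      (volume_openCompl_inter_Phi D U)
  have hclD : closure (openCompl f D U) ⊆ D := closure_minimal (openCompl_subset _ _) hD.isClosed
  rw [measure_eq_zero_iff_ae_notMem]
  filter_upwards [ae_mem_openCompl_iff hf hD hD0 hU hUD hU0, ae_mem_interior_Phi hf hU]
    with x h1 h2 hx
  rw [(isOpen_openCompl D U).frontier_eq] at hx
  have hP : x ∈ Phi f U := by
    by_contra hc
    exact hx.2 (h1.2 ⟨hclD hx.1, hc⟩)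
  exact (hdisj.closure_left isOpen_interior).le_bot ⟨hx.1, h2 hP⟩

/-- If an open set `U ⊆ D` with null boundary lies in `openCompl f D U` and in
`openCompl f D (openCompl f D U)`, then `W ↦ D \ Phi f W` has an open fixed point up to null sets:
the union of the increasing sequence of iterates of the squared operator, starting at `U`. -/
lemma exists_ae_fixed_openCompl (hf : IsIFS f) {D E U : Set (Space d)} (hD : IsCompact D)
    (hD0 : volume (frontier D) = 0) (hE : IsAttractor f E) (hE0 : volume E = 0)
    (hU : IsOpen U) (hUD : U ⊆ D) (hU0 : volume (frontier U) = 0)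
    (h1 : U ⊆ openCompl f D U) (h2 : U ⊆ openCompl f D (openCompl f D U)) :
    ∃ W : Set (Space d), IsOpen W ∧ W ⊆ openCompl f D U ∧
      (∀ᵐ x, x ∈ closure W → x ∈ W) ∧ ∀ᵐ x, x ∈ W ↔ x ∈ D ∧ x ∉ Phi f W := by
  set A : Set (Space d) → Set (Space d) := openCompl f D with hA
  set u : ℕ → Set (Space d) := fun n => (fun S => A (A S))^[n] U with hu
  set v : ℕ → Set (Space d) := fun n => A (u n) with hv
  have hsucc : ∀ n, u (n + 1) = A (v n) := fun n => by
    simp only [hu, hv, Function.iterate_succ_apply']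
  have hmono : Monotone u := monotone_nat_of_le_succ fun n => by
    induction n with
    | zero => exact h2
    | succ n ih =>
      rw [hsucc, hsucc]
      exact openCompl_anti (openCompl_anti ih)
  have hanti : Antitone v := fun m n hmn => openCompl_anti (hmono hmn)
  have huv : ∀ n, u n ⊆ v n := by
    intro n
    induction n with
    | zero => exact h1
    | succ n ih =>
      have h : u (n + 1) ⊆ v n := by rw [hsucc]; exact openCompl_anti ih
      nth_rw 1 [hsucc]
      exact openCompl_anti h
  have hreg : ∀ n, IsOpen (u n) ∧ u n ⊆ D ∧ volume (frontier (u n)) = 0 := by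
    intro n
    induction n with
    | zero => exact ⟨hU, hUD, hU0⟩
    | succ n ih =>
      rw [hsucc]
      exact ⟨isOpen_openCompl _ _, openCompl_subset _ _,
        volume_frontier_openCompl hf hD hD0 (isOpen_openCompl _ _) (openCompl_subset _ _)
          (volume_frontier_openCompl hf hD hD0 ih.1 ih.2.1 ih.2.2)⟩
  have hv0 : ∀ n, volume (frontier (v n)) = 0 := fun n =>
    volume_frontier_openCompl hf hD hD0 (hreg n).1 (hreg n).2.1 (hreg n).2.2
  have hv_iff : ∀ᵐ x, ∀ n, x ∈ v n ↔ x ∈ D ∧ x ∉ Phi f (u n) := ae_all_iff.2 fun n =>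
    ae_mem_openCompl_iff hf hD hD0 (hreg n).1 (hreg n).2.1 (hreg n).2.2
  have hu_iff : ∀ᵐ x, ∀ n, x ∈ u (n + 1) ↔ x ∈ D ∧ x ∉ Phi f (v n) := ae_all_iff.2 fun n => by
    rw [hsucc]
    exact ae_mem_openCompl_iff hf hD hD0 (isOpen_openCompl _ _) (openCompl_subset _ _) (hv0 n)
  set W : Set (Space d) := ⋃ n, u n with hW
  set Z : Set (Space d) := ⋂ n, v n with hZ
  have hWZ : ∀ n, W ⊆ v n := fun n => iUnion_subset fun m =>
    (hmono (le_max_left m n)).trans ((huv _).trans (hanti (le_max_right m n)))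
  have hZ_iff : ∀ᵐ x, x ∈ Z ↔ x ∈ D ∧ x ∉ Phi f W := by
    filter_upwards [hv_iff] with x hx
    have hP : x ∈ Phi f W ↔ ∃ n, x ∈ Phi f (u n) := by
      simp only [mem_Phi, hW, mem_iUnion]
      exact ⟨fun ⟨i, y, ⟨n, hn⟩, e⟩ => ⟨n, i, y, hn, e⟩, fun ⟨n, i, y, hn, e⟩ => ⟨i, y, ⟨n, hn⟩, e⟩⟩
    simp only [hZ, mem_iInter, hx, hP, not_exists]
    exact ⟨fun h => ⟨(h 0).1, fun n => (h n).2⟩, fun h n => ⟨h.1, h.2 n⟩⟩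
  have hW_iff : ∀ᵐ x, x ∈ W ↔ x ∈ D ∧ x ∉ Phi f Z := by
    filter_upwards [hu_iff] with x hx
    have e : x ∈ W ↔ ∃ n, x ∈ u (n + 1) := by
      rw [hW, mem_iUnion]
      exact ⟨fun ⟨n, hn⟩ => ⟨n, hmono n.le_succ hn⟩, fun ⟨n, hn⟩ => ⟨n + 1, hn⟩⟩
    rw [e, hZ, Phi_iInter_of_antitone hf hanti]
    simp only [hx, mem_iInter, not_forall, exists_and_left]
  have hnull : volume (Z \ W) = 0 := by
    refine volume_eq_zero_of_ae_subset_Phi hf hE hE0 (hD.isBounded.subset ?_) ?_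
    · exact sdiff_subset.trans ((iInter_subset _ 0).trans (openCompl_subset _ _))
    · filter_upwards [hZ_iff, hW_iff] with x hxZ hxW hx
      obtain ⟨hxD, hxP⟩ := hxZ.1 hx.1
      have hxPZ : x ∈ Phi f Z := by
        by_contra hc
        exact hx.2 (hxW.2 ⟨hxD, hc⟩)
      obtain ⟨i, y, hy, rfl⟩ := mem_Phi.1 hxPZ
      exact mem_Phi.2 ⟨i, y, ⟨hy, fun hyW => hxP (mem_Phi.2 ⟨i, y, hyW, rfl⟩)⟩, rfl⟩
  have hZW : ∀ᵐ x, x ∈ Z ↔ x ∈ W := by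
    filter_upwards [measure_eq_zero_iff_ae_notMem.1 hnull] with x hx
    refine ⟨fun h => ?_, fun h => mem_iInter.2 fun n => hWZ n h⟩
    by_contra hc
    exact hx ⟨h, hc⟩
  refine ⟨W, isOpen_iUnion fun n => (hreg n).1, hWZ 0, ?_, ?_⟩
  -- Null frontiers of the `u n` do not control that of their union; the bound comes from outside,
  -- via `closure W ⊆ closure (v n)` and `Z = W` almost everywhere.
  · have hcl : ∀ᵐ x, ∀ n, x ∈ closure (v n) → x ∈ v n :=
      ae_all_iff.2 fun n => ae_mem_of_mem_closure (isOpen_openCompl _ _) (hv0 n)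
    filter_upwards [hcl, hZW] with x hx hxZ hxW
    exact hxZ.1 (mem_iInter.2 fun n => hx n (closure_mono (hWZ n) hxW))
  · filter_upwards [hZW, hZ_iff] with x h1 h2
    exact h1.symm.trans h2

end Iteration

end Dissection

/-! ### The closure of the fixed point is a generator -/

open Dissection Set

theorem mainTheorem1 {d k : ℕ}
    (D : Set (Dissection.Space d)) (hD_compact : IsCompact D)
    (hD_regular : Dissection.IsRegularClosed D) (hD_frontier : volume (frontier D) = 0)
    (f : Fin k → Dissection.Space d → Dissection.Space d) (hf : Dissection.IsIFS f)
    (E : Set (Dissection.Space d)) (hE : Dissection.IsAttractor f E) (hE_null : volume E = 0)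
    (Y : Set (Dissection.Space d)) (hYD : Y ⊆ D)
    (hY_regular : Dissection.IsRegularClosed Y) (hY_frontier : volume (frontier Y) = 0)
    (hfY_subset : ∀ i, f i '' Y ⊆ D)
    (hfY_disjoint : Dissection.MutuallyDisjointInMeasure Y (fun i => f i '' Y))
    (hfC_subset : ∀ i, f i '' (D \ Dissection.Phi f Y) ⊆ D)
    (hfC_disjoint :
      Dissection.MutuallyDisjointInMeasure Y (fun i => f i '' (D \ Dissection.Phi f Y))) :
    Dissection.AdmitsDissection f D := by
  have hUD : interior Y ⊆ D := interior_subset.trans hYD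
  have hU0 : volume (frontier (interior Y)) = 0 :=
    measure_mono_null frontier_interior_subset hY_frontier
  have hYU : ∀ᵐ x, x ∈ Y → x ∈ interior Y := by
    filter_upwards [ae_notMem_frontier hY_frontier] with x hx hxY
    by_contra hc
    exact hx ⟨subset_closure hxY, hc⟩
  have hV : ∀ᵐ x, x ∈ openCompl f D (interior Y) → x ∈ D \ Phi f Y := by
    filter_upwards [ae_mem_openCompl_iff hf hD_compact hD_frontier isOpen_interior hUD hU0,
      ae_mem_Phi hf hYU] with x h1 h2 hx
    exact ⟨(h1.1 hx).1, fun h => (h1.1 hx).2 (h2 h)⟩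
  have h1 : interior Y ⊆ openCompl f D (interior Y) := by
    refine subset_openCompl isOpen_interior hUD ?_
    refine measure_mono_null (inter_subset_inter interior_subset (Phi_mono interior_subset)) ?_
    rw [Phi, inter_iUnion]
    exact measure_iUnion_null hfY_disjoint.1
  have h2 : interior Y ⊆ openCompl f D (openCompl f D (interior Y)) := by
    refine subset_openCompl isOpen_interior hUD ?_
    have h0 : volume (Y ∩ Phi f (D \ Phi f Y)) = 0 := by
      rw [Phi, inter_iUnion]
      exact measure_iUnion_null hfC_disjoint.1
    rw [measure_eq_zero_iff_ae_notMem] at h0 ⊢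
    filter_upwards [h0, ae_mem_Phi hf hV] with x h h' hx
    exact h ⟨interior_subset hx.1, h' hx.2⟩
  obtain ⟨W, hWo, hWV, hWcl, hW⟩ := exists_ae_fixed_openCompl hf hD_compact hD_frontier hE hE_null
    isOpen_interior hUD hU0 h1 h2
  have hXD : closure W ⊆ D :=
    closure_minimal (hWV.trans (openCompl_subset _ _)) hD_compact.isClosed
  have hXc : IsCompact (closure W) := hD_compact.of_isClosed_subset isClosed_closure hXD
  have hXC : ∀ᵐ x, x ∈ closure W → x ∈ D \ Phi f Y := by
    filter_upwards [hWcl, hV] with x hx hx' h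
    exact hx' (hWV (hx h))
  refine ⟨closure W, hXc, ?_, Subset.antisymm ?_ (union_subset hXD ?_), fun i => ?_,
    fun i j hij => ?_⟩
  · refine Subset.antisymm (closure_minimal interior_subset isClosed_closure) ?_
    exact closure_mono (hWo.subset_interior_iff.2 subset_closure)
  · have hcl : IsClosed (closure W ∪ Phi f (closure W)) :=
      (hXc.union (isCompact_Phi hf hXc)).isClosed
    have hsub : interior D ⊆ closure W ∪ Phi f (closure W) := by
      refine isOpen_subset_of_ae_mem isOpen_interior hcl ?_
      filter_upwards [hW] with x hx hxD
      by_cases hxP : x ∈ Phi f W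
      · exact Or.inr (Phi_mono subset_closure hxP)
      · exact Or.inl (subset_closure (hx.2 ⟨interior_subset hxD, hxP⟩))
    have := closure_minimal hsub hcl
    rwa [show closure (interior D) = D from hD_regular] at this
  -- Hypothesis 3 gives the inclusion only almost everywhere on the open set `openCompl f D
  -- (interior Y)`; closedness of `f i ⁻¹' D` removes the exception.
  · refine iUnion_subset fun i => image_subset_iff.2 ?_
    have hcl : IsClosed (f i ⁻¹' D) := hD_compact.isClosed.preimage (hf.continuous i)
    refine closure_minimal (hWV.trans ?_) hcl
    refine isOpen_subset_of_ae_mem (isOpen_openCompl _ _) hcl ?_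
    filter_upwards [hV] with x hx hxV
    exact hfC_subset i ⟨x, hx hxV, rfl⟩
  · rw [measure_eq_zero_iff_ae_notMem]
    filter_upwards [hWcl, ae_mem_image hf hWcl i, hW] with x hx hxi hxW h
    exact (hxW.1 (hx h.1)).2 (mem_iUnion.2 ⟨i, hxi h.2⟩)
  · have h0 := hfC_disjoint.2 i j hij
    rw [measure_eq_zero_iff_ae_notMem] at h0 ⊢
    filter_upwards [h0, ae_mem_image hf hXC i, ae_mem_image hf hXC j] with x hx hxi hxj h
    exact hx ⟨hxi h.1, hxj h.2⟩
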